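/- Let $(\Omega,\Sigma,\mathbb P)$ be a nonatomic probability space. Let $\Phi:[0,\infty)\to[0,\infty)$ be an Orlicz function (convex, increasing, $\Phi(0)=0$) with $\Phi(t)>0$ for all $t>0$ and $\lim_{t\to\infty}\Phi(t)/t=\infty$, and let $\Psi(s)=\sup\{ts-\Phi(t):t\ge 0\}$, $s\ge 0$, be its conjugate. For $F\in\{\Phi,\Psi\}$, let $L^F$ be the space of real random variables $X$ (modulo a.s. equality) with $\|X\|_F:=\inf\{\lambda>0:\mathbb E[F(|X|/\lambda)]\le 1\}<\infty$, and let $H^F$ be the Orlicz heart, i.e. the set of $X\in L^F$ with $\mathbb E[F(|X|/\lambda)]<\infty$ for all $\lambda>0$. Let $\sigma(H^\Phi,H^\Psi)$ be the coarsest topology on $H^\Phi$ for which all the maps $X\mapsto\mathbb E[XY]$, $Y\in H^\Psi$, are continuous. Say that $F$ satisfies the $\Delta_2$-condition if there are $t_0\in(0,\infty)$ and $k\in\mathbb R$ with $F(2t)<kF(t)$ for all $t\ge t_0$. If $\Phi$ and $\Psi$ both fail the $\Delta_2$-condition, then there is a set $\mathcal C\subset H^\Phi$ such that 1. $\mathcal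 C$ is monotone: if $X_1\in H^\Phi$, $X_2\in\mathcal C$ and $X_1\ge X_2$ a.s., then $X_1\in\mathcal C$; 2. $\mathcal C$ is positively homogeneous: $\lambda\mathcal C\subset\mathcal C$ for every real $\lambda\ge 0$; 3. $\mathcal C$ is additive: $\mathcal C+\mathcal C\subset\mathcal C$; 4. $\mathcal C$ is boundedly a.s. closed: if $(X_n)$ is a sequence in $\mathcal C$ with $\sup_n\|X_n\|_\Phi<\infty$ that converges a.s. to some $X\in H^\Phi$, then $X\in\mathcal C$; 5. $\mathcal C$ is not $\sigma(H^\Phi,H^\Psi)$-closed. -/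

import Mathlib

open MeasureTheory Filter Topology
open scoped NNReal ENNReal

noncomputable section

/-- An Orlicz function: a convex increasing function `Φ : [0,∞) → [0,∞)` with `Φ 0 = 0`. -/
structure IsOrliczFunction (Φ : ℝ≥0 → ℝ≥0) : Prop where
  convex : ConvexOn ℝ≥0 Set.univ Φ
  mono : Monotone Φ
  map_zero : Φ 0 = 0

/-- `Ψ` is the (finite-valued) conjugate of `Φ`: `Ψ s = sup {t s - Φ t : t ≥ 0}` for all `s ≥ 0`,
the supremum being taken in `ℝ`. -/
def IsOrliczConjugate (Φ Ψ : ℝ≥0 → ℝ≥0) : Prop :=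
  ∀ s : ℝ≥0, IsLUB (Set.range fun t : ℝ≥0 => (t : ℝ) * (s : ℝ) - (Φ t : ℝ)) (Ψ s : ℝ)

/-- The `Δ₂`-condition (for large arguments). -/
def SatisfiesDelta2 (Φ : ℝ≥0 → ℝ≥0) : Prop :=
  ∃ t₀ : ℝ≥0, 0 < t₀ ∧ ∃ k : ℝ, ∀ t : ℝ≥0, t₀ ≤ t → (Φ (2 * t) : ℝ) < k * (Φ t : ℝ)

/-- A measure is nonatomic if every measurable set of positive measure has a measurable subset of
strictly smaller positive measure. (Mathlib's singleton-based condition is not the same thing on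
general measurable spaces.) -/
def IsNonatomicMeasure {Ω : Type*} [MeasurableSpace Ω] (P : Measure Ω) : Prop :=
  ∀ A : Set Ω, MeasurableSet A → 0 < P A →
    ∃ B : Set Ω, B ⊆ A ∧ MeasurableSet B ∧ 0 < P B ∧ P B < P A

section Spaces

variable {Ω : Type*} [MeasurableSpace Ω]

/-- `E[Φ(|X| / r)]`, as an element of `[0,∞]`. -/
def orliczModular (Φ : ℝ≥0 → ℝ≥0) (P : Measure Ω) (X : Ω →ₘ[P] ℝ) (r : ℝ≥0) : ℝ≥0∞ :=
  ∫⁻ ω, (Φ (‖X ω‖₊ / r) : ℝ≥0∞) ∂P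

/-- The Luxemburg norm `inf {r > 0 : E[Φ(|X| / r)] ≤ 1}`, with value `∞` if there is no such `r`. -/
def luxemburgNorm (Φ : ℝ≥0 → ℝ≥0) (P : Measure Ω) (X : Ω →ₘ[P] ℝ) : ℝ≥0∞ :=
  ⨅ (r : ℝ≥0) (_ : 0 < r ∧ orliczModular Φ P X r ≤ 1), (r : ℝ≥0∞)

/-- The Orlicz space `L^Φ`: random variables modulo a.s. equality with finite Luxemburg norm. -/
def orliczSpace (Φ : ℝ≥0 → ℝ≥0) (P : Measure Ω) : Set (Ω →ₘ[P] ℝ) :=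
  {X | luxemburgNorm Φ P X < ∞}

/-- The Orlicz heart `H^Φ`: those `X ∈ L^Φ` with `E[Φ(|X| / r)] < ∞` for all `r > 0`. -/
def orliczHeart (Φ : ℝ≥0 → ℝ≥0) (P : Measure Ω) : Set (Ω →ₘ[P] ℝ) :=
  {X | X ∈ orliczSpace Φ P ∧ ∀ r : ℝ≥0, 0 < r → orliczModular Φ P X r < ∞}

/-- The weak topology `σ(H^Φ, H^Ψ)` on `H^Φ`: the coarsest topology making `X ↦ E[X Y]` continuous
for every `Y ∈ H^Ψ`, i.e. the topology of pointwise convergence on `H^Ψ`. -/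
abbrev heartWeakTopology (Φ Ψ : ℝ≥0 → ℝ≥0) (P : Measure Ω) :
    TopologicalSpace (orliczHeart Φ P) :=
  TopologicalSpace.induced
    (fun (X : orliczHeart Φ P) (Y : orliczHeart Ψ P) => ∫ ω, X.1 ω * Y.1 ω ∂P)
    Pi.topologicalSpace

/-- `C ⊆ H^Φ` is monotone: `H^Φ ∋ X₁ ≥ X₂ ∈ C` implies `X₁ ∈ C` (the order is the a.s. order). -/
def IsMonotoneSet (Φ : ℝ≥0 → ℝ≥0) (P : Measure Ω) (C : Set (Ω →ₘ[P] ℝ)) : Prop :=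
  ∀ X₁ ∈ orliczHeart Φ P, ∀ X₂ ∈ C, X₂ ≤ X₁ → X₁ ∈ C

/-- `r C ⊆ C` for all real `r ≥ 0`. -/
def IsPosHomogeneousSet (P : Measure Ω) (C : Set (Ω →ₘ[P] ℝ)) : Prop :=
  ∀ r : ℝ, 0 ≤ r → ∀ X ∈ C, r • X ∈ C

/-- `C + C ⊆ C`. -/
def IsAdditiveSet (P : Measure Ω) (C : Set (Ω →ₘ[P] ℝ)) : Prop :=
  ∀ X₁ ∈ C, ∀ X₂ ∈ C, X₁ + X₂ ∈ C

/-- `C ⊆ H^Φ` is boundedly a.s. closed: it contains every `X ∈ H^Φ` that is the a.s. limit of a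
norm bounded sequence in `C`. -/
def IsBoundedlyAEClosed (Φ : ℝ≥0 → ℝ≥0) (P : Measure Ω) (C : Set (Ω →ₘ[P] ℝ)) : Prop :=
  ∀ (U : ℕ → Ω →ₘ[P] ℝ) (X : Ω →ₘ[P] ℝ), (∀ n, U n ∈ C) →
    (∃ K : ℝ≥0, ∀ n, luxemburgNorm Φ P (U n) ≤ K) →
    X ∈ orliczHeart Φ P →
    (∀ᵐ ω ∂P, Tendsto (fun n => U n ω) atTop (𝓝 (X ω))) →
    X ∈ C

end Spaces

end

open MeasureTheory Filter Topology
open scoped NNReal ENNReal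

noncomputable section

/-! ### Sets of prescribed measure in a nonatomic space. -/

section Nonatomic

variable {Ω : Type*} [MeasurableSpace Ω] {P : Measure Ω} [IsProbabilityMeasure P]

/-! Failure of Δ₂ for Ψ yields steps `T` whose envelope g pairs finitely with L^Φ, and bumps a_m on
the m-th carrier of `T` with bounded Φ-modular and E[g · bump] ≥ 1, which nevertheless tend to 0
against every Y ∈ H^Ψ. Failure for Φ yields steps `S` no tail of which, however scaled, lies below
|X| + const with X ∈ H^Φ.

The block b(n,m) is the supremum of the `S`-steps with index in [n,m) plus (2^n + E g) times the
m-th bump. The cone consists of the X ∈ H^Φ with X + Σw ≥ max(0, Σ w_p b_p) for some summable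
weights w ≥ 0. Letting m → ∞ and then n → ∞, the functions b(n,m) - 1 tend weakly to -1
(`eventually_lintegral_block_mul_le`, `not_isClosed_of_blocks`). Since E[g(b(n,m) - 1)] ≥ 2^n,
pairing with g keeps -1 out of the cone (`not_mem_blockCone_of_ae_eq_neg_one`).

For bounded a.s. closedness, pass to limits of the weights. A norm bound controls E[g|X|], hence Σ
w_(n,m) 2^n (`Dominates.tsum_le`), so no mass escapes as n → ∞. Mass escaping as m → ∞ in row n
would leave a multiple of the whole tail of `S` from n on below the limit plus a constant, which
`OrliczSteps.not_ae_height_le` forbids. So the total weight converges, and Fatou's lemma gives the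
domination (`isBoundedlyAEClosed_blockCone`). -/

theorem IsNonatomicMeasure.exists_subset_le_div (hP : IsNonatomicMeasure P) {A : Set Ω}
    (hA : MeasurableSet A) (hA0 : 0 < P.real A) (n : ℕ) :
    ∃ B ⊆ A, MeasurableSet B ∧ 0 < P.real B ∧ P.real B ≤ P.real A / 2 ^ n := by
  induction n with
  | zero => exact ⟨A, subset_rfl, hA, hA0, by simp⟩
  | succ n ih =>
    obtain ⟨B, hBA, hB, hB0, hle⟩ := ih
    obtain ⟨D, hDB, hD, hD0, hlt⟩ := hP B hB (by
      rw [Measure.real, ENNReal.toReal_pos_iff] at hB0; exact hB0.1)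
    have hD0' : 0 < P.real D := ENNReal.toReal_pos hD0.ne' (measure_ne_top _ _)
    have hlt' : P.real D < P.real B :=
      (ENNReal.toReal_lt_toReal (measure_ne_top _ _) (measure_ne_top _ _)).2 hlt
    have hdiff : P.real (B \ D) = P.real B - P.real D := measureReal_sdiff hDB hD
    have hpow : P.real A / 2 ^ (n + 1) = P.real A / 2 ^ n / 2 := by rw [pow_succ, div_div]
    -- One of D and B \ D carries at most half of the measure of B, and both have positive measure.
    rcases le_total (P.real D) (P.real B / 2) with h | h
    · exact ⟨D, hDB.trans hBA, hD, hD0', by rw [hpow]; linarith⟩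
    · exact ⟨B \ D, Set.sdiff_subset.trans hBA, hB.diff hD, by linarith, by rw [hpow]; linarith⟩

/-- Sierpiński's theorem: a nonatomic probability measure attains all values in `[0, 1]`. -/
theorem IsNonatomicMeasure.exists_measureReal_eq (hP : IsNonatomicMeasure P) {p : ℝ}
    (hp0 : 0 ≤ p) (hp1 : p ≤ 1) : ∃ B, MeasurableSet B ∧ P.real B = p := by
  -- Greedy exhaustion: each extension is within 1/(n+1) of the largest admissible one. If the union
  -- fell short of p, a small set from its complement would violate this.
  have step : ∀ (B : {B : Set Ω // MeasurableSet B ∧ P.real B ≤ p}) (n : ℕ),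
      ∃ B' : {B : Set Ω // MeasurableSet B ∧ P.real B ≤ p}, B.1 ⊆ B'.1 ∧
        ∀ D, B.1 ⊆ D → MeasurableSet D → P.real D ≤ p →
          P.real D ≤ P.real B'.1 + 1 / ((n : ℝ) + 1) := by
    rintro ⟨B, hB, hBp⟩ n
    let S : Set ℝ := {x | ∃ D, B ⊆ D ∧ MeasurableSet D ∧ P.real D ≤ p ∧ P.real D = x}
    have hS : S.Nonempty := ⟨_, B, subset_rfl, hB, hBp, rfl⟩
    have hbdd : BddAbove S := ⟨p, by rintro _ ⟨D, -, -, h, rfl⟩; exact h⟩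
    obtain ⟨_, ⟨B', hBB', hB', hB'p, rfl⟩, hlt⟩ :=
      exists_lt_of_lt_csSup hS (sub_lt_self (sSup S) (Nat.one_div_pos_of_nat (α := ℝ) (n := n)))
    refine ⟨⟨B', hB', hB'p⟩, hBB', fun D hBD hD hDp => ?_⟩
    have := le_csSup hbdd ⟨D, hBD, hD, hDp, rfl⟩
    linarith
  choose next hsub hmax using step
  let B : ℕ → {B : Set Ω // MeasurableSet B ∧ P.real B ≤ p} :=
    fun n => Nat.rec ⟨∅, MeasurableSet.empty, by simpa using hp0⟩ (fun n b => next b n) n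
  have hmono : Monotone fun n => (B n).1 := monotone_nat_of_le_succ fun n => hsub (B n) n
  let U := ⋃ n, (B n).1
  have hU : MeasurableSet U := MeasurableSet.iUnion fun n => (B n).2.1
  have hUp : P.real U ≤ p := by
    have h := (ENNReal.tendsto_toReal (measure_ne_top P U)).comp
      (tendsto_measure_iUnion_atTop (μ := P) hmono)
    exact le_of_tendsto' h fun n => (B n).2.2
  refine ⟨U, hU, hUp.antisymm (not_lt.1 fun hlt => ?_)⟩
  have hUc : P.real Uᶜ = 1 - P.real U := probReal_compl_eq_one_sub hU
  have hc0 : 0 < P.real Uᶜ := by linarith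
  obtain ⟨n, hn⟩ := exists_pow_lt_of_lt_one (sub_pos.2 hlt) (y := (1 / 2 : ℝ)) (by norm_num)
  obtain ⟨D, hDU, hD, hD0, hDle⟩ := hP.exists_subset_le_div hU.compl hc0 n
  have hdisj : Disjoint U D := Set.disjoint_right.2 fun x hx => hDU hx
  have hun : P.real (U ∪ D) = P.real U + P.real D := measureReal_union hdisj hD
  have hDp : P.real D ≤ p - P.real U := by
    refine hDle.trans (le_trans ?_ hn.le)
    rw [one_div, inv_pow, ← one_div]
    gcongr
    exact measureReal_le_one
  obtain ⟨k, hk⟩ := exists_nat_one_div_lt hD0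
  have h1 := hmax (B k) k (U ∪ D) ((Set.subset_iUnion (fun n => (B n).1) k).trans
    Set.subset_union_left) (hU.union hD) (by linarith)
  have h2 : P.real (next (B k) k).1 ≤ P.real U :=
    measureReal_mono (Set.subset_iUnion (fun n => (B n).1) (k + 1))
  linarith

end Nonatomic

/-! ### Step functions from failure of Δ₂. -/

theorem exists_le_mul_of_not_satisfiesDelta2 {F : ℝ≥0 → ℝ≥0} (hF : ¬ SatisfiesDelta2 F)
    (t₀ k : ℝ≥0) : ∃ t, t₀ ≤ t ∧ k * F t ≤ F (2 * t) := by
  by_contra! h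
  refine hF ⟨t₀ + 1, by positivity, k, fun t ht => ?_⟩
  exact_mod_cast h t (le_self_add.trans ht)

/-- Heights `height k` and sets `carrier k` such that the envelope of the step functions
`height k * 1_{carrier k}` lies in the Orlicz space of `F` but not in its heart. -/
structure OrliczSteps {Ω : Type*} [MeasurableSpace Ω] (P : Measure Ω) (F : ℝ≥0 → ℝ≥0) where
  height : ℕ → ℝ≥0
  carrier : ℕ → Set Ω
  measurableSet_carrier : ∀ k, MeasurableSet (carrier k)
  tsum_measure_le : ∑' k, P (carrier k) ≤ 1
  tsum_modular_le : ∑' k, F (height k) * P (carrier k) ≤ 1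
  le_modular_two : ∀ k : ℕ, 4 * ((k : ℝ≥0∞) + 1) ≤ F (2 * height k) * P (carrier k)
  le_height : ∀ k : ℕ, (k : ℝ≥0) + 1 ≤ height k

theorem IsNonatomicMeasure.exists_measure_eq {Ω : Type*} [MeasurableSpace Ω] {P : Measure Ω}
    [IsProbabilityMeasure P] (hP : IsNonatomicMeasure P) {p : ℝ≥0} (hp : p ≤ 1) :
    ∃ B, MeasurableSet B ∧ P B = p := by
  obtain ⟨B, hB, h⟩ := hP.exists_measureReal_eq p.2 (by exact_mod_cast hp)
  refine ⟨B, hB, ?_⟩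
  rw [← ENNReal.coe_toNNReal (measure_ne_top P B)]
  congr 1
  exact NNReal.eq h

theorem ENNReal.tsum_coe_two_inv_pow_succ :
    ∑' k : ℕ, (((2⁻¹ : ℝ≥0) ^ (k + 1) : ℝ≥0) : ℝ≥0∞) = 1 := by
  have : ∀ k : ℕ, (((2⁻¹ : ℝ≥0) ^ (k + 1) : ℝ≥0) : ℝ≥0∞) = (2⁻¹ : ℝ≥0∞) ^ (k + 1) := by
    intro k; rw [ENNReal.coe_pow, ENNReal.coe_inv two_ne_zero]; norm_num
  simp_rw [this]
  rw [ENNReal.tsum_geometric_add_one, ENNReal.one_sub_inv_two, inv_inv]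
  exact ENNReal.inv_mul_cancel two_ne_zero ENNReal.ofNat_ne_top

/-- A carrier of measure 2^-(k+1) / F(s_k) gives its step modular 2^-(k+1), while failure of Δ₂
makes the modular of the doubled step as large as desired. Its growth in k excludes the heart; the
factor 4 serves the dual coefficients. -/
theorem exists_orliczSteps {Ω : Type*} [MeasurableSpace Ω] {P : Measure Ω}
    [IsProbabilityMeasure P] (hP : IsNonatomicMeasure P) {F : ℝ≥0 → ℝ≥0} (hmono : Monotone F)
    (htop : Tendsto F atTop atTop) (hF : ¬ SatisfiesDelta2 F) : Nonempty (OrliczSteps P F) := by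
  obtain ⟨T, hT⟩ := (htop.eventually_ge_atTop 1).exists
  choose s hs hs2 using fun k : ℕ => exists_le_mul_of_not_satisfiesDelta2 hF
    (T + (k + 1)) (4 * (k + 1) * 2 ^ (k + 1))
  have hF1 : ∀ k, 1 ≤ F (s k) := fun k => hT.trans (hmono (le_self_add.trans (hs k)))
  have hF0 : ∀ k, F (s k) ≠ 0 := fun k => (zero_lt_one.trans_le (hF1 k)).ne'
  have hle : ∀ k : ℕ, (2⁻¹ : ℝ≥0) ^ (k + 1) / F (s k) ≤ 2⁻¹ ^ (k + 1) := fun k =>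
    div_le_self (by positivity) (hF1 k)
  have hhalf : (2⁻¹ : ℝ≥0) ≤ 1 := by
    rw [inv_le_one₀ two_pos]; exact one_le_two
  choose B hB hPB using fun k : ℕ => hP.exists_measure_eq
    (p := 2⁻¹ ^ (k + 1) / F (s k)) ((hle k).trans (pow_le_one₀ (by positivity) hhalf))
  refine ⟨⟨s, B, hB, ?_, ?_, ?_, fun k => le_add_self.trans (hs k)⟩⟩
  · rw [← ENNReal.tsum_coe_two_inv_pow_succ]
    exact ENNReal.tsum_le_tsum fun k => by rw [hPB]; exact_mod_cast hle k
  · rw [← ENNReal.tsum_coe_two_inv_pow_succ]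
    refine ENNReal.tsum_le_tsum fun k => ?_
    rw [hPB, ← ENNReal.coe_mul, mul_div_cancel₀ _ (hF0 k)]
  · intro k
    rw [hPB]
    have : 4 * ((k : ℝ≥0) + 1) ≤ F (2 * s k) * (2⁻¹ ^ (k + 1) / F (s k)) := by
      calc 4 * ((k : ℝ≥0) + 1)
          = 4 * (k + 1) * 2 ^ (k + 1) * F (s k) * (2⁻¹ ^ (k + 1) / F (s k)) := by
            have := hF0 k
            rw [inv_pow]
            field_simp
        _ ≤ _ := by gcongr; exact hs2 k
    exact_mod_cast this

/-! ### Conjugate functions and convexity. -/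

namespace IsOrliczConjugate

variable {Φ Ψ : ℝ≥0 → ℝ≥0}

theorem young (h : IsOrliczConjugate Φ Ψ) (t s : ℝ≥0) : t * s ≤ Φ t + Ψ s := by
  have := (h s).1 ⟨t, rfl⟩
  rw [← NNReal.coe_le_coe]
  push_cast
  linarith

theorem monotone (h : IsOrliczConjugate Φ Ψ) : Monotone Ψ := fun s s' hs => by
  rw [← NNReal.coe_le_coe]
  refine (h s).2 ?_
  rintro _ ⟨t, rfl⟩
  refine le_trans ?_ ((h s').1 ⟨t, rfl⟩)
  have : (s : ℝ) ≤ s' := hs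
  dsimp only
  gcongr

theorem tendsto_atTop_atTop (h : IsOrliczConjugate Φ Ψ) : Tendsto Ψ atTop atTop := by
  refine Filter.tendsto_atTop.2 fun b => (eventually_ge_atTop (b + Φ 1)).mono fun s hs => ?_
  have := hs.trans (by simpa using h.young 1 s)
  rwa [add_comm, add_le_add_iff_left] at this

theorem exists_near_maximizer (h : IsOrliczConjugate Φ Ψ) {s : ℝ≥0} (hs : 0 < Ψ s) :
    ∃ t, Φ t ≤ t * s ∧ Ψ s ≤ 2 * (t * s) := by
  have hs' : (0 : ℝ) < Ψ s := hs
  obtain ⟨_, ⟨t, rfl⟩, hlt, -⟩ := (h s).exists_between (half_lt_self hs')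
  refine ⟨t, ?_, ?_⟩ <;> rw [← NNReal.coe_le_coe] <;> push_cast
  · dsimp only at hlt; linarith
  · have : (0 : ℝ) ≤ Φ t := (Φ t).2
    dsimp only at hlt; linarith

end IsOrliczConjugate

namespace IsOrliczFunction

variable {Φ : ℝ≥0 → ℝ≥0}

theorem map_mul_le (hΦ : IsOrliczFunction Φ) {θ : ℝ≥0} (hθ : θ ≤ 1) (t : ℝ≥0) :
    Φ (θ * t) ≤ θ * Φ t := by
  have := hΦ.convex.2 (Set.mem_univ t) (Set.mem_univ 0) zero_le zero_le
    (add_tsub_cancel_of_le hθ)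
  simpa [hΦ.map_zero] using this

end IsOrliczFunction

theorem tendsto_atTop_of_div_tendsto_atTop {F : ℝ≥0 → ℝ≥0}
    (h : Tendsto (fun t => F t / t) atTop atTop) : Tendsto F atTop atTop := by
  refine tendsto_atTop_mono' _ ?_ h
  filter_upwards [eventually_ge_atTop 1] with t ht
  exact div_le_self (zero_le) ht

/-! ### The Orlicz heart. -/

section Heart

variable {Ω : Type*} [MeasurableSpace Ω] {P : Measure Ω} {Φ : ℝ≥0 → ℝ≥0}

theorem orliczModular_mono (hmono : Monotone Φ) {X Y : Ω →ₘ[P] ℝ} {r s : ℝ≥0}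
    (h : ∀ᵐ ω ∂P, ‖X ω‖₊ / r ≤ ‖Y ω‖₊ / s) : orliczModular Φ P X r ≤ orliczModular Φ P Y s :=
  lintegral_mono_ae <| h.mono fun _ hω => by exact_mod_cast hmono hω

/-- By convexity, dividing X by c = 1 + E[Φ(|X|)] scales the modular by at most 1/c, so the norm is
automatically finite. -/
theorem mem_orliczHeart_iff (hΦ : IsOrliczFunction Φ) {X : Ω →ₘ[P] ℝ} :
    X ∈ orliczHeart Φ P ↔ ∀ r : ℝ≥0, 0 < r → orliczModular Φ P X r < ∞ := by
  refine ⟨fun h => h.2, fun h => ⟨?_, h⟩⟩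
  have h1 := (h 1 one_pos).ne
  set c : ℝ≥0 := (orliczModular Φ P X 1).toNNReal + 1 with hc
  have hc1 : 1 ≤ c := le_add_self
  have hc0 : c ≠ 0 := (zero_lt_one.trans_le hc1).ne'
  have hc' : 0 < c ∧ orliczModular Φ P X c ≤ 1 := ⟨zero_lt_one.trans_le hc1, ?_⟩
  · exact lt_of_le_of_lt (iInf₂_le (f := fun (r : ℝ≥0) _ => (r : ℝ≥0∞)) c hc')
      ENNReal.coe_lt_top
  calc orliczModular Φ P X c ≤ ∫⁻ ω, ((c⁻¹ : ℝ≥0) : ℝ≥0∞) * Φ (‖X ω‖₊ / 1) ∂P := by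
        refine lintegral_mono fun ω => ?_
        have := hΦ.map_mul_le (inv_le_one_of_one_le₀ hc1) (‖X ω‖₊ / 1)
        rw [div_one] at this ⊢
        rw [div_eq_inv_mul]
        simp only [← ENNReal.coe_mul, ENNReal.coe_le_coe]
        exact this
    _ = ((c⁻¹ : ℝ≥0) : ℝ≥0∞) * orliczModular Φ P X 1 :=
        lintegral_const_mul' _ _ ENNReal.coe_ne_top
    _ ≤ ((c⁻¹ : ℝ≥0) : ℝ≥0∞) * c := by
        gcongr
        rw [hc, ENNReal.coe_add, ENNReal.coe_toNNReal h1]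
        exact le_self_add
    _ = 1 := by rw [← ENNReal.coe_mul, inv_mul_cancel₀ hc0, ENNReal.coe_one]

theorem mem_orliczHeart_of_bounded [IsFiniteMeasure P] (hΦ : IsOrliczFunction Φ)
    {X : Ω →ₘ[P] ℝ} {K : ℝ≥0} (h : ∀ᵐ ω ∂P, ‖X ω‖₊ ≤ K) : X ∈ orliczHeart Φ P := by
  refine (mem_orliczHeart_iff hΦ).2 fun r hr => ?_
  refine lt_of_le_of_lt (lintegral_mono_ae (g := fun _ => (Φ (K / r) : ℝ≥0∞)) ?_) ?_
  · filter_upwards [h] with ω hω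
    exact_mod_cast hΦ.mono (by gcongr)
  · rw [lintegral_const]
    exact ENNReal.mul_lt_top ENNReal.coe_lt_top (measure_lt_top _ _)

theorem aemeasurable_modular (hmono : Monotone Φ) (X : Ω →ₘ[P] ℝ) (r : ℝ≥0) :
    AEMeasurable (fun ω => (Φ (‖X ω‖₊ / r) : ℝ≥0∞)) P :=
  (hmono.measurable.comp_aemeasurable
    (X.measurable.nnnorm.div_const r).aemeasurable).coe_nnreal_ennreal

theorem add_mem_orliczHeart (hΦ : IsOrliczFunction Φ) {X Y : Ω →ₘ[P] ℝ}
    (hX : X ∈ orliczHeart Φ P) (hY : Y ∈ orliczHeart Φ P) : X + Y ∈ orliczHeart Φ P := by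
  refine (mem_orliczHeart_iff hΦ).2 fun r hr => ?_
  have hr2 : 0 < r / 2 := by positivity
  refine lt_of_le_of_lt (lintegral_mono_ae (g := fun ω =>
    (Φ (‖X ω‖₊ / (r / 2)) : ℝ≥0∞) + Φ (‖Y ω‖₊ / (r / 2))) ?_) ?_
  · filter_upwards [AEEqFun.coeFn_add X Y] with ω hω
    rw [hω, ← ENNReal.coe_add, ENNReal.coe_le_coe]
    have hn : ‖X ω + Y ω‖₊ ≤ ‖X ω‖₊ + ‖Y ω‖₊ := nnnorm_add_le _ _
    have key : ∀ a b : ℝ≥0, a ≤ b → ‖X ω + Y ω‖₊ ≤ a + b →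
        Φ (‖X ω + Y ω‖₊ / r) ≤ Φ (b / (r / 2)) := fun a b hab h => by
      refine hΦ.mono ?_
      rw [div_div_eq_mul_div]
      gcongr
      exact h.trans (by rw [mul_two]; gcongr)
    rcases le_total ‖X ω‖₊ ‖Y ω‖₊ with h | h
    · exact (key _ _ h hn).trans le_add_self
    · exact (key _ _ h (hn.trans (add_comm _ _).le)).trans le_self_add
  · rw [lintegral_add_left' (aemeasurable_modular hΦ.mono X _)]
    exact ENNReal.add_lt_top.2 ⟨hX.2 _ hr2, hY.2 _ hr2⟩

theorem smul_mem_orliczHeart (hΦ : IsOrliczFunction Φ) {X : Ω →ₘ[P] ℝ}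
    (hX : X ∈ orliczHeart Φ P) (c : ℝ) : c • X ∈ orliczHeart Φ P := by
  refine (mem_orliczHeart_iff hΦ).2 fun r hr => ?_
  refine lt_of_le_of_lt (orliczModular_mono hΦ.mono (s := r / (‖c‖₊ + 1)) ?_)
    (hX.2 (r / (‖c‖₊ + 1)) (by positivity))
  filter_upwards [AEEqFun.coeFn_smul c X] with ω hω
  rw [hω, Pi.smul_apply, nnnorm_smul, div_div_eq_mul_div, mul_comm]
  gcongr
  exact le_self_add

theorem exists_modular_le_one {X : Ω →ₘ[P] ℝ} {K : ℝ≥0} (h : luxemburgNorm Φ P X ≤ K) :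
    ∃ r : ℝ≥0, 0 < r ∧ r ≤ K + 1 ∧ orliczModular Φ P X r ≤ 1 := by
  have hlt : luxemburgNorm Φ P X < ((K + 1 : ℝ≥0) : ℝ≥0∞) :=
    h.trans_lt (by exact_mod_cast lt_add_one K)
  simp only [luxemburgNorm, iInf_lt_iff] at hlt
  obtain ⟨r, ⟨hr, hm⟩, hlt⟩ := hlt
  exact ⟨r, hr, by exact_mod_cast hlt.le, hm⟩

/-- Young's inequality, scaled. -/
theorem mul_le_of_young {Ψ : ℝ≥0 → ℝ≥0} (hY : ∀ t s, t * s ≤ Φ t + Ψ s) {r : ℝ≥0} (hr : 0 < r)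
    (x s : ℝ≥0) : s * x ≤ r * (Φ (x / r) + Ψ s) :=
  calc s * x = r * (x / r * s) := by field_simp
    _ ≤ _ := by gcongr; exact hY _ _

/-- Elements of the heart of `Φ` are uniformly integrable against functions with bounded
`Ψ`-modular. -/
theorem exists_measure_lt_lintegral_le {Ψ : ℝ≥0 → ℝ≥0} (hY : ∀ t s, t * s ≤ Φ t + Ψ s)
    (hΦ : Monotone Φ) {X : Ω →ₘ[P] ℝ} (hX : ∀ r : ℝ≥0, 0 < r → orliczModular Φ P X r < ∞)
    {ε : ℝ≥0} (hε : 0 < ε) :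
    ∃ η : ℝ≥0∞, 0 < η ∧ ∀ (D : Set Ω) (h : Ω → ℝ≥0), MeasurableSet D → P D < η →
      (∀ ω ∉ D, h ω = 0) → ∫⁻ ω, Ψ (h ω) ∂P ≤ 2 → ∫⁻ ω, (h ω : ℝ≥0∞) * ‖X ω‖₊ ∂P ≤ 3 * ε := by
  -- Young's inequality at scale ε, with absolute continuity of the finite integral of Φ(|X|/ε);
  -- here 3 = 1 + 2.
  obtain ⟨η, hη, hη'⟩ := exists_pos_setLIntegral_lt_of_measure_lt (hX ε hε).ne one_ne_zero
  refine ⟨η, hη, fun D h hD hDη hsupp hmod => ?_⟩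
  calc ∫⁻ ω, (h ω : ℝ≥0∞) * ‖X ω‖₊ ∂P
      ≤ ∫⁻ ω, (ε : ℝ≥0∞) * (D.indicator (fun ω => (Φ (‖X ω‖₊ / ε) : ℝ≥0∞)) ω + Ψ (h ω)) ∂P := by
        refine lintegral_mono fun ω => ?_
        by_cases hω : ω ∈ D
        · rw [Set.indicator_of_mem hω]
          simp only [← ENNReal.coe_mul, ← ENNReal.coe_add, ENNReal.coe_le_coe]
          exact mul_le_of_young hY hε ‖X ω‖₊ (h ω)
        · simp [hsupp ω hω]
    _ = ε * (∫⁻ ω in D, (Φ (‖X ω‖₊ / ε) : ℝ≥0∞) ∂P + ∫⁻ ω, Ψ (h ω) ∂P) := by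
        rw [lintegral_const_mul' _ _ ENNReal.coe_ne_top,
          lintegral_add_left' ((aemeasurable_modular hΦ X ε).indicator hD),
          lintegral_indicator hD]
    _ ≤ ε * (1 + 2) := by gcongr; exact (hη' D hDη).le
    _ = 3 * ε := by rw [mul_comm]; norm_num

end Heart

/-! ### Envelopes of step functions. -/

namespace OrliczSteps

variable {Ω : Type*} [MeasurableSpace Ω] {P : Measure Ω} {F : ℝ≥0 → ℝ≥0} (S : OrliczSteps P F)

/-- The supremum of the step functions with index in `[n, m)`. -/
def partialEnvelope (n m : ℕ) (ω : Ω) : ℝ≥0 :=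
  (Finset.Ico n m).sup fun k => (S.carrier k).indicator (fun _ => S.height k) ω

/-- The supremum of all step functions. -/
def envelope (ω : Ω) : ℝ≥0∞ :=
  ⨆ k, (S.carrier k).indicator (fun _ => (S.height k : ℝ≥0∞)) ω

theorem measurable_partialEnvelope (n m : ℕ) : Measurable (S.partialEnvelope n m) := by
  have : S.partialEnvelope n m = (Finset.Ico n m).sup fun k =>
      (S.carrier k).indicator fun _ => S.height k := by
    ext ω; rw [Finset.sup_apply]; rfl
  rw [this]
  exact Finset.sup_induction measurable_const (fun _ hf _ hg => hf.sup hg) fun k _ =>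
    measurable_const.indicator (S.measurableSet_carrier k)

theorem measurable_envelope : Measurable S.envelope :=
  Measurable.iSup fun k => measurable_const.indicator (S.measurableSet_carrier k)

theorem height_le_envelope {k : ℕ} {ω : Ω} (h : ω ∈ S.carrier k) : S.height k ≤ S.envelope ω := by
  refine le_trans ?_ (le_iSup _ k)
  rw [Set.indicator_of_mem h]

theorem height_le_partialEnvelope {n m k : ℕ} (hn : n ≤ k) (hm : k < m) {ω : Ω}
    (h : ω ∈ S.carrier k) : S.height k ≤ S.partialEnvelope n m ω := by
  refine le_trans ?_ (Finset.le_sup (Finset.mem_Ico.2 ⟨hn, hm⟩))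
  rw [Set.indicator_of_mem h]

theorem partialEnvelope_le (n m : ℕ) (ω : Ω) :
    S.partialEnvelope n m ω ≤ (Finset.Ico n m).sup S.height :=
  Finset.sup_mono_fun fun _ _ => Set.indicator_le_self' (fun _ _ => zero_le) ω

theorem partialEnvelope_eq_zero {n m : ℕ} {ω : Ω} (h : ω ∉ ⋃ k ≥ n, S.carrier k) :
    S.partialEnvelope n m ω = 0 := by
  simp only [Set.mem_iUnion, not_exists] at h
  refine le_antisymm (Finset.sup_le fun k hk => ?_) (zero_le)
  rw [Set.indicator_of_notMem (h k (Finset.mem_Ico.1 hk).1)]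

theorem lintegral_tsum_indicator_le :
    ∫⁻ ω, ∑' k, (S.carrier k).indicator (fun _ => (F (S.height k) : ℝ≥0∞)) ω ∂P ≤ 1 := by
  rw [lintegral_tsum fun k => (measurable_const.indicator (S.measurableSet_carrier k)).aemeasurable]
  refine le_trans (le_of_eq (tsum_congr fun k => ?_)) S.tsum_modular_le
  rw [lintegral_indicator_const (S.measurableSet_carrier k)]

theorem lintegral_partialEnvelope_le (hF : Monotone F) (hF0 : F 0 = 0) (n m : ℕ) :
    ∫⁻ ω, F (S.partialEnvelope n m ω) ∂P ≤ 1 := by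
  refine le_trans (lintegral_mono fun ω => ?_) S.lintegral_tsum_indicator_le
  have h : ∀ s : Finset ℕ, (F (s.sup fun k => (S.carrier k).indicator (fun _ => S.height k) ω)
      : ℝ≥0∞) ≤ ∑' k, (S.carrier k).indicator (fun _ => (F (S.height k) : ℝ≥0∞)) ω := fun s => by
    rw [Finset.apply_sup_eq_sup_comp_of_linearOrder F hF hF0]
    rcases s.eq_empty_or_nonempty with rfl | hs
    · simp
    · obtain ⟨k, -, hk⟩ := Finset.exists_mem_eq_sup s hs
        (F ∘ fun k => (S.carrier k).indicator (fun _ => S.height k) ω)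
      rw [hk]
      refine le_trans (le_of_eq ?_) (ENNReal.le_tsum k)
      by_cases hω : ω ∈ S.carrier k <;> simp [hω, hF0]
  exact h _

theorem tendsto_measure_iUnion_ge : Tendsto (fun n => P (⋃ k ≥ n, S.carrier k)) atTop (𝓝 0) := by
  refine tendsto_of_tendsto_of_tendsto_of_le_of_le tendsto_const_nhds
    (ENNReal.tendsto_sum_nat_add (fun k => P (S.carrier k))
      (ne_top_of_le_ne_top ENNReal.one_ne_top S.tsum_measure_le)) (fun _ => zero_le) fun n => ?_
  refine le_trans (measure_mono ?_) (measure_iUnion_le fun k => S.carrier (k + n))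
  refine Set.iUnion₂_subset fun k hk => ?_
  obtain ⟨j, rfl⟩ := Nat.exists_eq_add_of_le' hk
  exact Set.subset_iUnion (fun k => S.carrier (k + n)) j

/-- Young's inequality on each step separately; the modulars of the steps sum to at most 1, so the
bound survives the supremum. -/
theorem lintegral_envelope_mul_le {Φ : ℝ≥0 → ℝ≥0} (hY : ∀ t s, t * s ≤ Φ t + F s)
    (hΦ : Monotone Φ) (X : Ω →ₘ[P] ℝ) {r : ℝ≥0} (hr : 0 < r) :
    ∫⁻ ω, S.envelope ω * ‖X ω‖₊ ∂P ≤ r * (orliczModular Φ P X r + 1) :=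
  calc ∫⁻ ω, S.envelope ω * ‖X ω‖₊ ∂P
      ≤ ∫⁻ ω, (r : ℝ≥0∞) * ((Φ (‖X ω‖₊ / r) : ℝ≥0∞) +
          ∑' k, (S.carrier k).indicator (fun _ => (F (S.height k) : ℝ≥0∞)) ω) ∂P := by
        refine lintegral_mono fun ω => ?_
        rw [envelope, ENNReal.iSup_mul]
        refine iSup_le fun k => ?_
        by_cases hω : ω ∈ S.carrier k
        · rw [Set.indicator_of_mem hω]
          refine le_trans ?_ (mul_le_mul_right (add_le_add_right (ENNReal.le_tsum k) _) _)
          rw [Set.indicator_of_mem hω]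
          simp only [← ENNReal.coe_mul, ← ENNReal.coe_add, ENNReal.coe_le_coe]
          exact mul_le_of_young hY hr ‖X ω‖₊ (S.height k)
        · simp [hω]
    _ ≤ r * (orliczModular Φ P X r + 1) := by
        rw [lintegral_const_mul' _ _ ENNReal.coe_ne_top,
          lintegral_add_left' (aemeasurable_modular hΦ X r)]
        gcongr
        · exact le_rfl
        · exact S.lintegral_tsum_indicator_le

/-- For large j the constant L is at most half of δ · height, so |X|/(δ/4) ≥ 2 · height on the j-th
carrier. The modular of X at δ/4 would then exceed 4(j+1) for all large j. -/
theorem not_ae_height_le (hF : Monotone F) {X : Ω →ₘ[P] ℝ} (hX : X ∈ orliczHeart F P)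
    {δ : ℝ≥0} (hδ : 0 < δ) (L : ℝ≥0) (n : ℕ)
    (h : ∀ j ≥ n, ∀ᵐ ω ∂P, ω ∈ S.carrier j → δ * S.height j ≤ ‖X ω‖₊ + L) : False := by
  have hfin := hX.2 (δ / 4) (by positivity)
  obtain ⟨N, hN⟩ := ENNReal.exists_nat_gt hfin.ne
  obtain ⟨M, hM⟩ := exists_nat_gt (2 * L / δ)
  set j := max n (max N M) with hj
  have hLj : 2 * L ≤ δ * S.height j := by
    rw [div_lt_iff₀ hδ] at hM
    refine hM.le.trans ?_
    rw [mul_comm]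
    gcongr
    refine le_trans ?_ (S.le_height j)
    refine le_trans ?_ le_self_add
    exact_mod_cast (le_max_right N M).trans (le_max_right n _)
  have h1 : F (2 * S.height j) * P (S.carrier j) ≤ orliczModular F P X (δ / 4) := by
    rw [← lintegral_indicator_const (S.measurableSet_carrier j)]
    refine lintegral_mono_ae ?_
    filter_upwards [h j (le_max_left _ _)] with ω hω
    by_cases hmem : ω ∈ S.carrier j
    · rw [Set.indicator_of_mem hmem, ENNReal.coe_le_coe]
      refine hF ?_
      rw [le_div_iff₀ (by positivity)]
      have := hω hmem
      rw [← NNReal.coe_le_coe] at *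
      push_cast at *
      linarith
    · simp [hmem]
  have h2 : (N : ℝ≥0∞) ≤ 4 * ((j : ℝ≥0∞) + 1) := by
    have : N ≤ 4 * (j + 1) := by
      have := (le_max_left N M).trans (le_max_right n _); omega
    exact_mod_cast this
  exact absurd ((h2.trans (S.le_modular_two j)).trans h1) (not_le.2 hN)

end OrliczSteps

/-! ### The cone and its pairing with g. -/

section Cone

variable {Ω : Type*} [MeasurableSpace Ω]

/-- `X + L` dominates the combination of the blocks `b p` with weights `w p`, where `L` is the
total weight. -/
structure Dominates (P : Measure Ω) (b : ℕ × ℕ → Ω → ℝ≥0) (X : Ω →ₘ[P] ℝ) (w : ℕ × ℕ → ℝ≥0∞)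
    (L : ℝ≥0) : Prop where
  tsum_eq : ∑' p, w p = L
  ae_le : ∀ᵐ ω ∂P, 0 ≤ X ω + L ∧ ∑' p, w p * b p ω ≤ ENNReal.ofReal (X ω + L)

/-- The monotone convex cone in the Orlicz heart generated by the functions `b p - 1`, closed
under countable combinations with summable weights. -/
def blockCone (Φ : ℝ≥0 → ℝ≥0) (P : Measure Ω) (b : ℕ × ℕ → Ω → ℝ≥0) : Set (Ω →ₘ[P] ℝ) :=
  {X | X ∈ orliczHeart Φ P ∧ ∃ w L, Dominates P b X w L}

variable {P : Measure Ω} {Φ : ℝ≥0 → ℝ≥0} {b : ℕ × ℕ → Ω → ℝ≥0}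

theorem isMonotoneSet_blockCone : IsMonotoneSet Φ P (blockCone Φ P b) := by
  rintro X hX Y ⟨-, w, L, hw, h⟩ hYX
  refine ⟨hX, w, L, hw, ?_⟩
  filter_upwards [h, AEEqFun.coeFn_le.2 hYX] with ω hω hle
  exact ⟨hω.1.trans (by gcongr), hω.2.trans (ENNReal.ofReal_le_ofReal (by gcongr))⟩

theorem isPosHomogeneousSet_blockCone (hΦ : IsOrliczFunction Φ) :
    IsPosHomogeneousSet P (blockCone Φ P b) := by
  rintro r hr X ⟨hX, w, L, hw, h⟩
  lift r to ℝ≥0 using hr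
  refine ⟨smul_mem_orliczHeart hΦ hX _, fun p => r * w p, r * L, ?_, ?_⟩
  · rw [ENNReal.tsum_mul_left, hw, ENNReal.coe_mul]
  · filter_upwards [h, AEEqFun.coeFn_smul (r : ℝ) X] with ω hω hs
    have he : ((r : ℝ) • X) ω + ((r * L : ℝ≥0) : ℝ) = r * (X ω + L) := by
      rw [hs, Pi.smul_apply, smul_eq_mul]; push_cast; ring
    rw [he]
    refine ⟨mul_nonneg r.2 hω.1, ?_⟩
    simp_rw [mul_assoc]
    rw [ENNReal.tsum_mul_left, ENNReal.ofReal_mul r.coe_nonneg, ENNReal.ofReal_coe_nnreal]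
    gcongr
    exact hω.2

theorem isAdditiveSet_blockCone (hΦ : IsOrliczFunction Φ) :
    IsAdditiveSet P (blockCone Φ P b) := by
  rintro X ⟨hX, w, L, hw, h⟩ Y ⟨hY, w', L', hw', h'⟩
  refine ⟨add_mem_orliczHeart hΦ hX hY, fun p => w p + w' p, L + L', ?_, ?_⟩
  · rw [ENNReal.tsum_add, hw, hw', ENNReal.coe_add]
  · filter_upwards [h, h', AEEqFun.coeFn_add X Y] with ω hω hω' hs
    have he : (X + Y) ω + ((L + L' : ℝ≥0) : ℝ) = (X ω + L) + (Y ω + L') := by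
      rw [hs, Pi.add_apply]; push_cast; ring
    rw [he]
    refine ⟨add_nonneg hω.1 hω'.1, ?_⟩
    simp_rw [add_mul]
    rw [ENNReal.tsum_add, ENNReal.ofReal_add hω.1 hω'.1]
    exact add_le_add hω.2 hω'.2

theorem mem_blockCone_of_ae_eq [IsProbabilityMeasure P] {p : ℕ × ℕ} {X : Ω →ₘ[P] ℝ}
    (hX : X ∈ orliczHeart Φ P) (h : ∀ᵐ ω ∂P, X ω = b p ω - 1) : X ∈ blockCone Φ P b := by
  refine ⟨hX, fun q => if q = p then 1 else 0, 1, by simp, ?_⟩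
  filter_upwards [h] with ω hω
  rw [hω]
  simp

/-- Integrating the domination against a positive function `g`. -/
theorem Dominates.tsum_add_le (hb : ∀ p, Measurable (b p)) {g : Ω → ℝ≥0∞} (hg : Measurable g)
    (hgb : ∀ p, 2 ^ p.1 + ∫⁻ ω, g ω ∂P ≤ ∫⁻ ω, g ω * b p ω ∂P) {X : Ω →ₘ[P] ℝ}
    {w : ℕ × ℕ → ℝ≥0∞} {L : ℝ≥0} (h : Dominates P b X w L) :
    ∑' p, w p * 2 ^ p.1 + L * ∫⁻ ω, g ω ∂P ≤ ∫⁻ ω, g ω * ENNReal.ofReal (X ω + L) ∂P :=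
  calc ∑' p, w p * 2 ^ p.1 + L * ∫⁻ ω, g ω ∂P
      = ∑' p, w p * (2 ^ p.1 + ∫⁻ ω, g ω ∂P) := by
        simp_rw [mul_add]
        rw [ENNReal.tsum_add, ENNReal.tsum_mul_right, h.tsum_eq]
    _ ≤ ∑' p, w p * ∫⁻ ω, g ω * b p ω ∂P := ENNReal.tsum_le_tsum fun p => by gcongr; exact hgb p
    _ = ∫⁻ ω, ∑' p, w p * (g ω * b p ω) ∂P := by
        have hm : ∀ p, Measurable fun ω => g ω * b p ω := fun p =>
          hg.mul (hb p).coe_nnreal_ennreal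
        rw [lintegral_tsum fun p => ((hm p).const_mul (w p)).aemeasurable]
        exact tsum_congr fun p => (lintegral_const_mul _ (hm p)).symm
    _ ≤ _ := by
        refine lintegral_mono_ae (h.ae_le.mono fun ω hω => ?_)
        simp_rw [mul_left_comm]
        rw [ENNReal.tsum_mul_left]
        gcongr
        exact hω.2

/-- The term L · E g occurs on both sides and cancels, leaving a bound on the weights that does not
involve L. -/
theorem Dominates.tsum_le (hb : ∀ p, Measurable (b p)) {g : Ω → ℝ≥0∞} (hg : Measurable g)
    (hgfin : ∫⁻ ω, g ω ∂P ≠ ∞)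
    (hgb : ∀ p, 2 ^ p.1 + ∫⁻ ω, g ω ∂P ≤ ∫⁻ ω, g ω * b p ω ∂P) {X : Ω →ₘ[P] ℝ}
    {w : ℕ × ℕ → ℝ≥0∞} {L : ℝ≥0} (h : Dominates P b X w L) :
    ∑' p, w p * 2 ^ p.1 ≤ ∫⁻ ω, g ω * ‖X ω‖₊ ∂P := by
  have hle : ∫⁻ ω, g ω * ENNReal.ofReal (X ω + L) ∂P ≤
      ∫⁻ ω, g ω * ‖X ω‖₊ ∂P + L * ∫⁻ ω, g ω ∂P := by
    rw [← lintegral_const_mul _ hg, ← lintegral_add_right _ (hg.const_mul _)]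
    refine lintegral_mono fun ω => ?_
    rw [mul_comm (L : ℝ≥0∞), ← mul_add]
    gcongr
    refine ENNReal.ofReal_add_le.trans ?_
    rw [ENNReal.ofReal_coe_nnreal]
    gcongr
    exact Real.ofReal_le_enorm _
  exact (ENNReal.add_le_add_iff_right (ENNReal.mul_ne_top ENNReal.coe_ne_top hgfin)).1
    ((h.tsum_add_le hb hg hgb).trans hle)

/-- Nonnegativity of L - 1 forces L ≥ 1, whereas pairing with g gives L + L · E g ≤ L · E g, so L =
0. -/
theorem not_mem_blockCone_of_ae_eq_neg_one [IsProbabilityMeasure P] (hb : ∀ p, Measurable (b p))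
    {g : Ω → ℝ≥0∞} (hg : Measurable g) (hgfin : ∫⁻ ω, g ω ∂P ≠ ∞)
    (hgb : ∀ p, 2 ^ p.1 + ∫⁻ ω, g ω ∂P ≤ ∫⁻ ω, g ω * b p ω ∂P) {X : Ω →ₘ[P] ℝ}
    (hX : ∀ᵐ ω ∂P, X ω = -1) : X ∉ blockCone Φ P b := by
  rintro ⟨-, w, L, h⟩
  obtain ⟨ω, hω, hXω⟩ := (h.ae_le.and hX).exists
  have hL : (1 : ℝ) ≤ L := by have := hω.1; rw [hXω] at this; linarith
  have h1 : (L : ℝ≥0∞) + L * ∫⁻ ω, g ω ∂P ≤ 0 + L * ∫⁻ ω, g ω ∂P := by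
    calc (L : ℝ≥0∞) + L * ∫⁻ ω, g ω ∂P
        ≤ ∑' p, w p * 2 ^ p.1 + L * ∫⁻ ω, g ω ∂P := by
          gcongr
          rw [← h.tsum_eq]
          exact ENNReal.tsum_le_tsum fun p => le_mul_of_one_le_right' (one_le_pow₀ one_le_two)
      _ ≤ ∫⁻ ω, g ω * ENNReal.ofReal (X ω + L) ∂P := h.tsum_add_le hb hg hgb
      _ ≤ ∫⁻ ω, L * g ω ∂P := by
          refine lintegral_mono_ae (hX.mono fun ω hω => ?_)
          rw [hω, mul_comm]
          gcongr
          refine (ENNReal.ofReal_le_ofReal (q := (L : ℝ)) (by linarith)).trans ?_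
          rw [ENNReal.ofReal_coe_nnreal]
      _ = 0 + L * ∫⁻ ω, g ω ∂P := by rw [lintegral_const_mul _ hg, zero_add]
  have h2 := (ENNReal.add_le_add_iff_right (ENNReal.mul_ne_top ENNReal.coe_ne_top hgfin)).1 h1
  have h3 : L = 0 := by simpa using h2
  rw [h3] at hL
  norm_num at hL

end Cone

/-! ### Limits of weights and series. -/

section Compactness

theorem exists_subseq_tendsto_ennreal {ι κ : Type*} [Countable ι] [Countable κ]
    (w : ℕ → ι → ℝ≥0∞) (R : ℕ → κ → ℝ≥0∞) :
    ∃ (w' : ι → ℝ≥0∞) (R' : κ → ℝ≥0∞) (φ : ℕ → ℕ), StrictMono φ ∧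
      (∀ i, Tendsto (fun k => w (φ k) i) atTop (𝓝 (w' i))) ∧
      ∀ j, Tendsto (fun k => R (φ k) j) atTop (𝓝 (R' j)) := by
  obtain ⟨⟨w', R'⟩, -, φ, hφ, h⟩ := (isCompact_univ (X := (ι → ℝ≥0∞) × (κ → ℝ≥0∞))).tendsto_subseq
    (x := fun k => (w k, R k)) fun _ => Set.mem_univ _
  rw [Prod.tendsto_iff] at h
  exact ⟨w', R', φ, hφ, tendsto_pi_nhds.1 h.1, tendsto_pi_nhds.1 h.2⟩

theorem ENNReal.tendsto_tsum_of_dominated {f : ℕ → ℕ → ℝ≥0∞} {g bound : ℕ → ℝ≥0∞}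
    (hb : ∀ k i, f k i ≤ bound i) (hfin : ∑' i, bound i ≠ ∞)
    (h : ∀ i, Tendsto (fun k => f k i) atTop (𝓝 (g i))) :
    Tendsto (fun k => ∑' i, f k i) atTop (𝓝 (∑' i, g i)) := by
  simp_rw [← lintegral_count] at hfin ⊢
  exact tendsto_lintegral_of_dominated_convergence bound (fun _ => measurable_of_countable _)
    (fun k => ae_of_all _ (hb k)) hfin (ae_of_all _ h)

/-- Fatou's lemma for series of nonnegative terms. -/
theorem ENNReal.tsum_le_of_tendsto {ι : Type*} {f : ℕ → ι → ℝ≥0∞} {g : ι → ℝ≥0∞} {c : ℕ → ℝ≥0∞}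
    {d : ℝ≥0∞} (h : ∀ i, Tendsto (fun k => f k i) atTop (𝓝 (g i))) (hc : ∀ k, ∑' i, f k i ≤ c k)
    (hd : Tendsto c atTop (𝓝 d)) : ∑' i, g i ≤ d := by
  rw [ENNReal.tsum_eq_iSup_sum]
  exact iSup_le fun s => le_of_tendsto_of_tendsto' (tendsto_finsetSum s fun i _ => h i) hd
    fun k => (ENNReal.sum_le_tsum s).trans (hc k)

end Compactness

/-! ### Bounded a.s. closedness. -/

section Closed

variable {Ω : Type*} [MeasurableSpace Ω] {P : Measure Ω} {Φ : ℝ≥0 → ℝ≥0} {b : ℕ × ℕ → Ω → ℝ≥0}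

theorem isBoundedlyAEClosed_blockCone [IsProbabilityMeasure P] (hΦ : IsOrliczFunction Φ)
    (S : OrliczSteps P Φ)
    (hbS : ∀ n m j ω, n ≤ j → j < m → ω ∈ S.carrier j → S.height j ≤ b (n, m) ω)
    (hbound : ∀ K : ℝ≥0, ∃ K' : ℝ≥0, ∀ X w L, luxemburgNorm Φ P X ≤ K → Dominates P b X w L →
      ∑' p, w p * 2 ^ p.1 ≤ K') :
    IsBoundedlyAEClosed Φ P (blockCone Φ P b) := by
  rintro U X hU ⟨K, hK⟩ hX hlim
  choose hUH w L hdom using hU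
  obtain ⟨K', hK'⟩ := hbound K
  have hsum : ∀ k, ∑' p, w k p * 2 ^ p.1 ≤ K' := fun k => hK' _ _ _ (hK k) (hdom k)
  -- Row masses need their own limits: a row may lose mass as m → ∞ even if every single weight
  -- converges.
  let R : ℕ → ℕ → ℝ≥0∞ := fun k n => ∑' m, w k (n, m)
  obtain ⟨w', R', φ, hφ, hw', hR'⟩ := exists_subseq_tendsto_ennreal w R
  have hRle : ∀ k n, R k n ≤ K' * 2⁻¹ ^ n := fun k n => by
    have h1 : R k n * 2 ^ n ≤ K' := by
      refine le_trans ?_ (hsum k)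
      rw [ENNReal.tsum_prod' (f := fun p : ℕ × ℕ => w k p * 2 ^ p.1), ← ENNReal.tsum_mul_right]
      exact ENNReal.le_tsum (f := fun n => ∑' m, w k (n, m) * 2 ^ n) n
    rw [← ENNReal.inv_pow, ← div_eq_mul_inv]
    exact (ENNReal.le_div_iff_mul_le (Or.inl (by simp)) (Or.inl (by simp))).2 h1
  have hgeom : ∑' n : ℕ, (K' : ℝ≥0∞) * 2⁻¹ ^ n ≠ ∞ := by
    rw [ENNReal.tsum_mul_left, ENNReal.tsum_geometric_two]
    exact ENNReal.mul_ne_top ENNReal.coe_ne_top ENNReal.ofNat_ne_top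
  have hR'le : ∀ n, R' n ≤ K' * 2⁻¹ ^ n := fun n => le_of_tendsto' (hR' n) fun k => hRle _ n
  have hfin : ∑' n, R' n ≠ ∞ := ne_top_of_le_ne_top hgeom (ENNReal.tsum_le_tsum hR'le)
  obtain ⟨L', hL'⟩ : ∃ x : ℝ≥0, (x : ℝ≥0∞) = ∑' n, R' n := ⟨_, ENNReal.coe_toNNReal hfin⟩
  have hRL : ∀ k, ∑' n, R k n = L k := fun k => by
    rw [← (hdom k).tsum_eq, ENNReal.tsum_prod']
  have hLlim : Tendsto (fun k => L (φ k)) atTop (𝓝 L') := by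
    rw [← ENNReal.tendsto_coe, hL']
    simp_rw [← hRL]
    exact ENNReal.tendsto_tsum_of_dominated (fun k => hRle (φ k)) hgeom hR'
  have hXlim : ∀ᵐ ω ∂P, Tendsto (fun k => U (φ k) ω + L (φ k)) atTop (𝓝 (X ω + L')) :=
    hlim.mono fun ω hω => (hω.comp hφ.tendsto_atTop).add ((NNReal.tendsto_coe).2 hLlim)
  have hall := ae_all_iff.2 fun k => (hdom (φ k)).ae_le
  have hrow_le : ∀ n, ∑' m, w' (n, m) ≤ R' n := fun n =>
    ENNReal.tsum_le_of_tendsto (fun m => hw' (n, m)) (fun k => le_refl (R (φ k) n)) (hR' n)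
  have hrow : ∀ n, ∑' m, w' (n, m) = R' n := by
    intro n
    refine (hrow_le n).antisymm (not_lt.1 fun hlt => ?_)
    have hR'fin : R' n ≠ ∞ := ne_top_of_le_ne_top hfin (ENNReal.le_tsum n)
    obtain ⟨ρ, hρ⟩ : ∃ x : ℝ≥0, (x : ℝ≥0∞) = R' n := ⟨_, ENNReal.coe_toNNReal hR'fin⟩
    obtain ⟨τ, hτ⟩ : ∃ x : ℝ≥0, (x : ℝ≥0∞) = ∑' m, w' (n, m) := ⟨_, ENNReal.coe_toNNReal (hlt.trans_le le_top).ne⟩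
    rw [← hρ, ← hτ, ENNReal.coe_lt_coe] at hlt
    refine S.not_ae_height_le hΦ.mono hX (tsub_pos_of_lt hlt) L' n fun j hj => ?_
    filter_upwards [hall, hXlim] with ω hω hωlim hmem
    -- Only weights with m ≤ j are split off; each block with m > j is at least the j-th height
    -- here. In the limit, the mass lost by the row multiplies that height.
    have hstep : ∀ k, R (φ k) n * S.height j ≤
        (∑ m ∈ Finset.range (j + 1), w (φ k) (n, m)) * S.height j +
          ENNReal.ofReal (U (φ k) ω + L (φ k)) := fun k => by
      have hsplit : R (φ k) n = ∑ m ∈ Finset.range (j + 1), w (φ k) (n, m) +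
          ∑' m, w (φ k) (n, m + (j + 1)) :=
        (ENNReal.summable.sum_add_tsum_nat_add' ).symm
      rw [hsplit, add_mul]
      gcongr
      refine le_trans ?_ (hω k).2
      rw [ENNReal.tsum_prod' (f := fun p : ℕ × ℕ => w (φ k) p * b p ω), ← ENNReal.tsum_mul_right]
      refine le_trans ?_ (ENNReal.le_tsum n)
      refine le_trans ?_ (ENNReal.tsum_comp_le_tsum_of_injective (add_left_injective (j + 1)) _)
      refine ENNReal.tsum_le_tsum fun m => ?_
      gcongr
      exact hbS _ _ _ _ hj (by omega) hmem
    have hlim2 : R' n * S.height j ≤ (∑ m ∈ Finset.range (j + 1), w' (n, m)) * S.height j +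
        ENNReal.ofReal (X ω + L') :=
      le_of_tendsto_of_tendsto' (ENNReal.Tendsto.mul_const (hR' n) (Or.inr ENNReal.coe_ne_top))
        ((ENNReal.Tendsto.mul_const (tendsto_finsetSum _ fun m _ => hw' (n, m))
          (Or.inr ENNReal.coe_ne_top)).add ((ENNReal.continuous_ofReal.tendsto _).comp hωlim))
        hstep
    have hlim3 : (ρ : ℝ≥0∞) * S.height j ≤ τ * S.height j + ((‖X ω‖₊ + L' : ℝ≥0) : ℝ≥0∞) := by
      rw [hρ, hτ]
      refine hlim2.trans (add_le_add (by gcongr; exact ENNReal.sum_le_tsum _) ?_)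
      refine ENNReal.ofReal_add_le.trans ?_
      rw [ENNReal.ofReal_coe_nnreal, ENNReal.coe_add]
      gcongr
      exact Real.ofReal_le_enorm _
    rw [← ENNReal.coe_mul, ← ENNReal.coe_mul, ← ENNReal.coe_add, ENNReal.coe_le_coe] at hlim3
    rw [tsub_mul]
    exact tsub_le_iff_left.2 hlim3
  refine ⟨hX, w', L', ?_, ?_⟩
  · rw [ENNReal.tsum_prod' (f := w'), hL']
    exact tsum_congr hrow
  · filter_upwards [hall, hXlim] with ω hω hωlim
    refine ⟨ge_of_tendsto' hωlim fun k => (hω k).1, ?_⟩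
    exact ENNReal.tsum_le_of_tendsto
      (fun p => ENNReal.Tendsto.mul_const (hw' p) (Or.inr ENNReal.coe_ne_top))
      (fun k => (hω k).2) ((ENNReal.continuous_ofReal.tendsto _).comp hωlim)

end Closed

/-! ### Bumps dual to the steps of `T`. -/

section Bumps

variable {Ω : Type*} [MeasurableSpace Ω] {P : Measure Ω} [IsProbabilityMeasure P]
  {Φ Ψ : ℝ≥0 → ℝ≥0}

/-- With q the measure of the carrier and s its height, a near-maximizer t for Ψ(2s) satisfies 4 ≤
Ψ(2s)q ≤ 4tsq and Φ(t) ≤ 2ts. Dividing t by tsq ≥ 1 normalizes the pairing to 1, and convexity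
bounds the modular by 2. -/
theorem OrliczSteps.exists_dual_coefficient (hΦ : IsOrliczFunction Φ)
    (hΨ : IsOrliczConjugate Φ Ψ) (T : OrliczSteps P Ψ) (k : ℕ) :
    ∃ a : ℝ≥0, Φ a * P (T.carrier k) ≤ 2 ∧ 1 ≤ (T.height k : ℝ≥0∞) * a * P (T.carrier k) := by
  obtain ⟨q, hq⟩ : ∃ q : ℝ≥0, (q : ℝ≥0∞) = P (T.carrier k) :=
    ⟨_, ENNReal.coe_toNNReal (measure_ne_top _ _)⟩
  set s := T.height k
  have h4 : 4 ≤ Ψ (2 * s) * q := by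
    have := T.le_modular_two k
    rw [← hq] at this
    have h' : 4 * ((k : ℝ≥0) + 1) ≤ Ψ (2 * s) * q := by exact_mod_cast this
    refine le_trans ?_ h'
    exact le_mul_of_one_le_right' le_add_self
  have hΨpos : 0 < Ψ (2 * s) := by
    by_contra h0
    rw [not_lt, nonpos_iff_eq_zero] at h0
    rw [h0, zero_mul] at h4
    norm_num at h4
  have hqpos : 0 < q := by
    by_contra h0
    rw [not_lt, nonpos_iff_eq_zero] at h0
    rw [h0, mul_zero] at h4
    norm_num at h4
  obtain ⟨t, ht1, ht2⟩ := hΨ.exists_near_maximizer hΨpos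
  have hone : 1 ≤ t * s * q := by
    have : 4 ≤ 4 * (t * s * q) := h4.trans <| by
      calc Ψ (2 * s) * q ≤ 2 * (t * (2 * s)) * q := by gcongr
        _ = 4 * (t * s * q) := by ring
    rw [← NNReal.coe_le_coe] at *
    push_cast at *
    linarith
  have hpos : 0 < t * s * q := zero_lt_one.trans_le hone
  refine ⟨(t * s * q)⁻¹ * t, ?_, ?_⟩ <;> rw [← hq]
  · have : Φ ((t * s * q)⁻¹ * t) * q ≤ 2 := by
      calc Φ ((t * s * q)⁻¹ * t) * q ≤ (t * s * q)⁻¹ * Φ t * q := by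
            gcongr; exact hΦ.map_mul_le (inv_le_one_of_one_le₀ hone) t
        _ ≤ (t * s * q)⁻¹ * (t * (2 * s)) * q := by gcongr
        _ = (t * s * q)⁻¹ * (t * s * q) * 2 := by ring
        _ = 2 := by rw [inv_mul_cancel₀ hpos.ne', one_mul]
    exact_mod_cast this
  · have : 1 ≤ s * ((t * s * q)⁻¹ * t) * q := by
      calc (1 : ℝ≥0) = (t * s * q)⁻¹ * (t * s * q) := (inv_mul_cancel₀ hpos.ne').symm
        _ = s * ((t * s * q)⁻¹ * t) * q := by ring
        _ ≤ _ := le_rfl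
    exact_mod_cast this

end Bumps

/-! ### The generating blocks. -/

section Blocks

variable {Ω : Type*} [MeasurableSpace Ω] {P : Measure Ω} {Φ Ψ : ℝ≥0 → ℝ≥0}

/-- The functions generating the cone: truncations of the envelope of `S` plus large multiples
of small bumps carried by the steps of `T`. -/
def block (S : OrliczSteps P Φ) (T : OrliczSteps P Ψ) (a : ℕ → ℝ≥0) (c : ℝ≥0) (p : ℕ × ℕ)
    (ω : Ω) : ℝ≥0 :=
  S.partialEnvelope p.1 p.2 ω + (2 ^ p.1 + c) * (T.carrier p.2).indicator (fun _ => a p.2) ω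

variable (S : OrliczSteps P Φ) (T : OrliczSteps P Ψ) (a : ℕ → ℝ≥0) (c : ℝ≥0)

theorem measurable_block (p : ℕ × ℕ) : Measurable (block S T a c p) :=
  (S.measurable_partialEnvelope _ _).add
    ((measurable_const.indicator (T.measurableSet_carrier _)).const_mul _)

theorem block_le (p : ℕ × ℕ) (ω : Ω) :
    block S T a c p ω ≤ (Finset.Ico p.1 p.2).sup S.height + (2 ^ p.1 + c) * a p.2 := by
  unfold block
  gcongr
  · exact S.partialEnvelope_le _ _ _
  · exact Set.indicator_le_self' (fun _ _ => zero_le) ω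

theorem height_le_block (n m j : ℕ) (ω : Ω) (hn : n ≤ j) (hm : j < m) (h : ω ∈ S.carrier j) :
    S.height j ≤ block S T a c (n, m) ω :=
  (S.height_le_partialEnvelope hn hm h).trans le_self_add

theorem le_lintegral_envelope_mul_block
    (ha : ∀ k, 1 ≤ (T.height k : ℝ≥0∞) * a k * P (T.carrier k)) (p : ℕ × ℕ) :
    2 ^ p.1 + (c : ℝ≥0∞) ≤ ∫⁻ ω, T.envelope ω * block S T a c p ω ∂P :=
  calc 2 ^ p.1 + (c : ℝ≥0∞)
      ≤ (2 ^ p.1 + c) * ((T.height p.2 : ℝ≥0∞) * a p.2 * P (T.carrier p.2)) :=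
        le_mul_of_one_le_right' (ha p.2)
    _ = ∫⁻ ω, (T.carrier p.2).indicator
          (fun _ => (2 ^ p.1 + (c : ℝ≥0∞)) * (T.height p.2 * a p.2)) ω ∂P := by
        rw [lintegral_indicator_const (T.measurableSet_carrier _), ← mul_assoc]
    _ ≤ _ := by
        refine lintegral_mono fun ω => ?_
        by_cases hω : ω ∈ T.carrier p.2
        · rw [Set.indicator_of_mem hω, mul_left_comm]
          refine mul_le_mul' (T.height_le_envelope hω) ?_
          rw [block, Set.indicator_of_mem hω, ENNReal.coe_add]
          refine le_trans ?_ le_add_self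
          simp
        · simp [hω]

/-- A large n makes the carriers of the `S`-tail small. Only then is m chosen, depending on n, so
that the bump beats its factor 2^n + c; hence an iterated limit. -/
theorem eventually_lintegral_block_mul_le (hΦ : IsOrliczFunction Φ)
    (hY : ∀ t s, t * s ≤ Ψ t + Φ s) (hΨ : Monotone Ψ)
    (ha : ∀ k, Φ (a k) * P (T.carrier k) ≤ 2) {Y : Ω →ₘ[P] ℝ} (hYH : Y ∈ orliczHeart Ψ P)
    {ε : ℝ≥0} (hε : 0 < ε) :
    ∀ᶠ n in atTop, ∀ᶠ m in atTop,
      ∫⁻ ω, (block S T a c (n, m) ω : ℝ≥0∞) * ‖Y ω‖₊ ∂P ≤ 6 * ε := by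
  obtain ⟨η, hη, h⟩ := exists_measure_lt_lintegral_le hY hΨ hYH.2 hε
  filter_upwards [S.tendsto_measure_iUnion_ge.eventually_lt_const hη] with n hn
  have hc : 0 < (2 : ℝ≥0) ^ n + c := by positivity
  obtain ⟨η', hη', h'⟩ := exists_measure_lt_lintegral_le hY hΨ hYH.2 (div_pos hε hc)
  filter_upwards [(ENNReal.tendsto_atTop_zero_of_tsum_ne_top
    (ne_top_of_le_ne_top ENNReal.one_ne_top T.tsum_measure_le)).eventually_lt_const hη'] with m hm
  have h1 : ∫⁻ ω, (S.partialEnvelope n m ω : ℝ≥0∞) * ‖Y ω‖₊ ∂P ≤ 3 * ε :=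
    h _ _ (MeasurableSet.iUnion fun k => MeasurableSet.iUnion fun _ => S.measurableSet_carrier k)
      hn (fun ω hω => S.partialEnvelope_eq_zero hω)
      ((S.lintegral_partialEnvelope_le hΦ.mono hΦ.map_zero n m).trans one_le_two)
  set f : Ω → ℝ≥0 := (T.carrier m).indicator fun _ => a m with hf
  have h2 : ∫⁻ ω, (f ω : ℝ≥0∞) * ‖Y ω‖₊ ∂P ≤
      3 * (ε / (2 ^ n + c) : ℝ≥0) := by
    refine h' _ f (T.measurableSet_carrier m) hm
      (fun ω hω => Set.indicator_of_notMem hω _) ?_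
    refine le_trans (le_of_eq ?_) (ha m)
    rw [← lintegral_indicator_const (T.measurableSet_carrier m)]
    refine lintegral_congr fun ω => ?_
    by_cases hω : ω ∈ T.carrier m <;> simp [hf, hω, hΦ.map_zero]
  calc ∫⁻ ω, (block S T a c (n, m) ω : ℝ≥0∞) * ‖Y ω‖₊ ∂P
      = ∫⁻ ω, (S.partialEnvelope n m ω : ℝ≥0∞) * ‖Y ω‖₊ + ((2 ^ n + c : ℝ≥0) : ℝ≥0∞) *
          ((f ω : ℝ≥0∞) * ‖Y ω‖₊) ∂P := by
        refine lintegral_congr fun ω => ?_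
        rw [block, ENNReal.coe_add, ENNReal.coe_mul, add_mul, mul_assoc]
    _ = ∫⁻ ω, (S.partialEnvelope n m ω : ℝ≥0∞) * ‖Y ω‖₊ ∂P + ((2 ^ n + c : ℝ≥0) : ℝ≥0∞) *
          ∫⁻ ω, (f ω : ℝ≥0∞) * ‖Y ω‖₊ ∂P := by
        have hm : Measurable fun ω => (S.partialEnvelope n m ω : ℝ≥0∞) * ‖Y ω‖₊ :=
          (S.measurable_partialEnvelope n m).coe_nnreal_ennreal.mul
            Y.measurable.nnnorm.coe_nnreal_ennreal
        rw [lintegral_add_left hm, lintegral_const_mul' _ _ ENNReal.coe_ne_top]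
    _ ≤ 3 * ε + ((2 ^ n + c : ℝ≥0) : ℝ≥0∞) * (3 * (ε / (2 ^ n + c) : ℝ≥0)) := by gcongr
    _ = 6 * ε := by
        have : 3 * ε + (2 ^ n + c) * (3 * (ε / (2 ^ n + c))) = 6 * ε := by
          field_simp; ring
        exact_mod_cast this

end Blocks

/-! ### Weak limits of the blocks. -/

theorem integrable_of_mem_orliczHeart {Ω : Type*} [MeasurableSpace Ω] {P : Measure Ω}
    [IsProbabilityMeasure P] {Φ Ψ : ℝ≥0 → ℝ≥0} (hY : ∀ t s, t * s ≤ Φ t + Ψ s)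
    {Y : Ω →ₘ[P] ℝ} (hYH : Y ∈ orliczHeart Ψ P) : Integrable Y P := by
  refine ⟨Y.aestronglyMeasurable, ?_⟩
  have h1 := hYH.2 1 one_pos
  calc ∫⁻ ω, ‖Y ω‖ₑ ∂P ≤ ∫⁻ ω, (Φ 1 : ℝ≥0∞) + Ψ (‖Y ω‖₊ / 1) ∂P := by
        refine lintegral_mono fun ω => ?_
        rw [enorm_eq_nnnorm, ← ENNReal.coe_add, ENNReal.coe_le_coe, div_one]
        simpa using hY 1 ‖Y ω‖₊
    _ = Φ 1 + orliczModular Ψ P Y 1 := by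
        rw [lintegral_add_left measurable_const, lintegral_const, measure_univ, mul_one]
        rfl
    _ < ∞ := ENNReal.add_lt_top.2 ⟨ENNReal.coe_lt_top, h1⟩

/-- The element of the weak closure: bounded functions `b p - 1` whose nonnegative parts `b p`
become small against every `Y` converge weakly to `-1`. -/
theorem not_isClosed_of_blocks {Ω : Type*} [MeasurableSpace Ω] {P : Measure Ω}
    [IsProbabilityMeasure P] {Φ Ψ : ℝ≥0 → ℝ≥0} (hΦ : IsOrliczFunction Φ)
    (hY : ∀ t s, t * s ≤ Φ t + Ψ s) {b : ℕ × ℕ → Ω → ℝ≥0}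
    (hb : ∀ p, Measurable (b p)) (hbdd : ∀ p, ∃ K, ∀ ω, b p ω ≤ K)
    (hsmall : ∀ Y ∈ orliczHeart Ψ P, ∀ ε : ℝ≥0, 0 < ε → ∀ᶠ n in atTop, ∀ᶠ m in atTop,
      ∫⁻ ω, (b (n, m) ω : ℝ≥0∞) * ‖Y ω‖₊ ∂P ≤ 6 * ε)
    {C : Set (Ω →ₘ[P] ℝ)}
    (hmem : ∀ p, ∀ X ∈ orliczHeart Φ P, (∀ᵐ ω ∂P, X ω = b p ω - 1) → X ∈ C)
    (hnot : ∀ X : Ω →ₘ[P] ℝ, (∀ᵐ ω ∂P, X ω = -1) → X ∉ C) :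
    ¬ IsClosed[heartWeakTopology Φ Ψ P] ((↑) ⁻¹' C : Set (orliczHeart Φ P)) := by
  intro hclosed
  have hX0ae : ∀ᵐ ω ∂P, (AEEqFun.const Ω (-1 : ℝ) : Ω →ₘ[P] ℝ) ω = -1 :=
    AEEqFun.coeFn_const Ω (-1 : ℝ)
  let X₀ : orliczHeart Φ P := ⟨AEEqFun.const Ω (-1 : ℝ),
    mem_orliczHeart_of_bounded (K := 1) hΦ <| hX0ae.mono fun ω hω => by simp [hω]⟩
  have hmeas : ∀ p, Measurable fun ω => (b p ω : ℝ) - 1 := fun p =>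
    (hb p).coe_nnreal_real.sub_const 1
  let X' : ℕ × ℕ → Ω →ₘ[P] ℝ := fun p => AEEqFun.mk _ (hmeas p).aestronglyMeasurable
  have hX'ae : ∀ p, ∀ᵐ ω ∂P, X' p ω = b p ω - 1 := fun p => AEEqFun.coeFn_mk _ _
  have hX'H : ∀ p, X' p ∈ orliczHeart Φ P := fun p => by
    obtain ⟨K, hK⟩ := hbdd p
    refine mem_orliczHeart_of_bounded (K := K + 1) hΦ <| (hX'ae p).mono fun ω hω => ?_
    rw [hω]
    refine (nnnorm_sub_le _ _).trans ?_
    rw [nnnorm_one, NNReal.nnnorm_eq]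
    gcongr
    exact hK ω
  let X : ℕ × ℕ → orliczHeart Φ P := fun p => ⟨X' p, hX'H p⟩
  let _ := heartWeakTopology Φ Ψ P
  -- The curried filter encodes the iterated limit: m first, then n.
  have hlim : Tendsto X (atTop.curry atTop) (𝓝 X₀) := by
    rw [nhds_induced, tendsto_comap_iff, tendsto_pi_nhds]
    rintro ⟨Y, hYH⟩
    have hYint := integrable_of_mem_orliczHeart hY hYH
    rw [Metric.tendsto_nhds]
    intro ε hε
    rw [eventually_curry_iff]
    lift ε to ℝ≥0 using hε.le
    -- 6 · ε/7 < ε gives the strict inequality.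
    have hε' : 0 < ε / 7 := by have : 0 < ε := hε; positivity
    refine (hsmall Y hYH _ hε').mono fun n hn => hn.mono fun m hm => ?_
    have hfin : 6 * ((ε / 7 : ℝ≥0) : ℝ≥0∞) ≠ ∞ := by
      exact ENNReal.mul_ne_top ENNReal.ofNat_ne_top ENNReal.coe_ne_top
    have henorm : ∀ ω, ‖(b (n, m) ω : ℝ) * Y ω‖ₑ = b (n, m) ω * ‖Y ω‖₊ := fun ω => by
      rw [enorm_mul, enorm_eq_nnnorm, enorm_eq_nnnorm, NNReal.nnnorm_eq]
    have hbint : Integrable (fun ω => (b (n, m) ω : ℝ) * Y ω) P := by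
      refine ⟨(hb _).coe_nnreal_real.aestronglyMeasurable.mul Y.aestronglyMeasurable, ?_⟩
      rw [hasFiniteIntegral_def]
      simp_rw [henorm]
      exact hm.trans_lt hfin.lt_top
    have h1 : ∫ ω, X' (n, m) ω * Y ω ∂P = ∫ ω, (b (n, m) ω : ℝ) * Y ω ∂P - ∫ ω, Y ω ∂P := by
      rw [← integral_sub hbint hYint]
      refine integral_congr_ae ((hX'ae (n, m)).mono fun ω hω => ?_)
      dsimp only
      rw [hω]; ring
    have h2 : ∫ ω, X₀.1 ω * Y ω ∂P = - ∫ ω, Y ω ∂P := by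
      rw [← integral_neg]
      refine integral_congr_ae (hX0ae.mono fun ω hω => ?_)
      change (AEEqFun.const Ω (-1 : ℝ) : Ω →ₘ[P] ℝ) ω * Y ω = _
      rw [hω]; ring
    have h3 : ‖∫ ω, (b (n, m) ω : ℝ) * Y ω ∂P‖ₑ ≤ 6 * ((ε / 7 : ℝ≥0) : ℝ≥0∞) := by
      refine (enorm_integral_le_lintegral_enorm _).trans ?_
      simp_rw [henorm]
      exact hm
    have h4 : ‖∫ ω, (b (n, m) ω : ℝ) * Y ω ∂P‖₊ ≤ 6 * (ε / 7) := by
      rw [enorm_eq_nnnorm] at h3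
      exact_mod_cast h3
    change dist (∫ ω, X' (n, m) ω * Y ω ∂P) (∫ ω, X₀.1 ω * Y ω ∂P) < ε
    rw [h1, h2, Real.dist_eq, sub_neg_eq_add, sub_add_cancel, ← Real.norm_eq_abs, ← coe_nnnorm]
    have h5 : ((‖∫ ω, (b (n, m) ω : ℝ) * Y ω ∂P‖₊ : ℝ≥0) : ℝ) ≤ 6 * (ε / 7) := by
      exact_mod_cast h4
    have hε0 : (0 : ℝ) < ε := hε
    linarith
  have : (atTop.curry atTop : Filter (ℕ × ℕ)).NeBot := ⟨fun h => by
    have hbot : ∀ᶠ _ in (atTop.curry atTop : Filter (ℕ × ℕ)), False := by rw [h]; trivial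
    rw [eventually_curry_iff] at hbot
    exact hbot.exists.elim fun _ hn => hn.exists.elim fun _ hf => hf⟩
  exact hnot X₀.1 hX0ae (hclosed.mem_of_tendsto hlim
    (Eventually.of_forall fun p => hmem p _ (hX'H p) (hX'ae p)))

end

theorem lemma4p4 {Ω : Type*} [MeasurableSpace Ω] (P : Measure Ω) [IsProbabilityMeasure P]
    (hP : IsNonatomicMeasure P)
    (Φ Ψ : ℝ≥0 → ℝ≥0) (hΦ : IsOrliczFunction Φ) (hΨ : IsOrliczConjugate Φ Ψ)
    (hΦ_lim : Tendsto (fun t : ℝ≥0 => Φ t / t) atTop atTop)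
    (hΦ_pos : ∀ t : ℝ≥0, 0 < t → 0 < Φ t)
    (hΦ_fail : ¬ SatisfiesDelta2 Φ) (hΨ_fail : ¬ SatisfiesDelta2 Ψ) :
    ∃ C : Set (Ω →ₘ[P] ℝ), C ⊆ orliczHeart Φ P ∧
      IsMonotoneSet Φ P C ∧ IsPosHomogeneousSet P C ∧ IsAdditiveSet P C ∧
      IsBoundedlyAEClosed Φ P C ∧
      ¬ IsClosed[heartWeakTopology Φ Ψ P] ((↑) ⁻¹' C : Set (orliczHeart Φ P)) := by
  obtain ⟨S⟩ := exists_orliczSteps hP hΦ.mono (tendsto_atTop_of_div_tendsto_atTop hΦ_lim) hΦ_fail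
  obtain ⟨T⟩ := exists_orliczSteps hP hΨ.monotone hΨ.tendsto_atTop_atTop hΨ_fail
  choose a ha2 ha1 using T.exists_dual_coefficient hΦ hΨ
  have hgX : ∀ K : ℝ≥0, ∀ X : Ω →ₘ[P] ℝ, luxemburgNorm Φ P X ≤ K →
      ∫⁻ ω, T.envelope ω * ‖X ω‖₊ ∂P ≤ ((K + 1) * 2 : ℝ≥0) := fun K X hX => by
    obtain ⟨r, hr, hrK, hmod⟩ := exists_modular_le_one hX
    calc ∫⁻ ω, T.envelope ω * ‖X ω‖₊ ∂P
        ≤ r * (orliczModular Φ P X r + 1) := T.lintegral_envelope_mul_le hΨ.young hΦ.mono X hr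
      _ ≤ ((K + 1 : ℝ≥0) : ℝ≥0∞) * (1 + 1) := by gcongr
      _ = ((K + 1) * 2 : ℝ≥0) := by rw [ENNReal.coe_mul]; norm_num
  -- Test the pairing bound on the constant 1.
  have hgfin : ∫⁻ ω, T.envelope ω ∂P ≠ ∞ := by
    have hone : ∀ᵐ ω ∂P, (AEEqFun.const Ω (1 : ℝ) : Ω →ₘ[P] ℝ) ω = 1 :=
      AEEqFun.coeFn_const Ω (1 : ℝ)
    have hH : AEEqFun.const Ω (1 : ℝ) ∈ orliczHeart Φ P :=
      mem_orliczHeart_of_bounded (K := 1) hΦ (hone.mono fun ω hω => by simp [hω])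
    have hle := hgX (luxemburgNorm Φ P (AEEqFun.const Ω (1 : ℝ))).toNNReal _
      (ENNReal.coe_toNNReal (ne_of_lt hH.1)).ge
    refine ne_top_of_le_ne_top ENNReal.coe_ne_top (le_trans (lintegral_mono_ae ?_) hle)
    filter_upwards [hone] with ω hω
    simp [hω]
  obtain ⟨c, hc⟩ : ∃ c : ℝ≥0, (c : ℝ≥0∞) = ∫⁻ ω, T.envelope ω ∂P :=
    ⟨_, ENNReal.coe_toNNReal hgfin⟩
  have hbm := measurable_block S T a c
  have hgb : ∀ p, 2 ^ p.1 + ∫⁻ ω, T.envelope ω ∂P ≤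
      ∫⁻ ω, T.envelope ω * block S T a c p ω ∂P := fun p =>
    hc ▸ le_lintegral_envelope_mul_block S T a c ha1 p
  refine ⟨blockCone Φ P (block S T a c), fun X hX => hX.1, isMonotoneSet_blockCone,
    isPosHomogeneousSet_blockCone hΦ, isAdditiveSet_blockCone hΦ,
    isBoundedlyAEClosed_blockCone hΦ S (height_le_block S T a c) fun K =>
      ⟨(K + 1) * 2, fun X w L hX hdom =>
        (hdom.tsum_le hbm T.measurable_envelope hgfin hgb).trans (hgX K X hX)⟩, ?_⟩
  refine not_isClosed_of_blocks hΦ hΨ.young hbm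
    (fun p => ⟨_, block_le S T a c p⟩) (fun Y hY ε hε => ?_)
    (fun p X hX h => mem_blockCone_of_ae_eq hX h)
    (fun X hX => not_mem_blockCone_of_ae_eq_neg_one hbm T.measurable_envelope hgfin hgb hX)
  refine eventually_lintegral_block_mul_le S T a c hΦ (fun t s => ?_) hΨ.monotone ha2 hY hε
  rw [mul_comm, add_comm]
  exact hΨ.young s t
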